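/- Let $n\ge 0$ and $A_0,A_1\in\mathbb{C}^{n\times n}$, and consider the delay differential equation with one delay $x'(t)=A_0x(t)+A_1x(t-\tau)$. It is called absolutely stable if for every $\tau\ge 0$ all roots $\lambda\in\mathbb{C}$ of $\det\left[\lambda I-A_0-A_1e^{-\lambda\tau}\right]=0$ satisfy $\Re\lambda<0$. For $\omega,\varphi\in\mathbb{R}$ let the extended singular map be the discrete dynamical system $$x(T)=(i\omega I-A_0)^{-1}A_1e^{i\varphi}\,x(T-1),\qquad x(T)\in\mathbb{C}^n .$$ A linear map $x(T)=Mx(T-1)$ is called exponentially stable if there are $C\ge0$ and $0\le r<1$ with $\|x(T)\|\le C r^{T}\|x(0)\|$ for all its orbits and all $T\in\mathbb{N}$; its multipliers are the eigenvalues of $M$; it is called neutral if all multipliers satisfy $|\mu|\le1$ and at least one satisfies $|\mu|=1$. Then the equation is absolutely stable if and only if the following three conditions hold: 1. $A_0$ is Hurwitz, i.e. every eigenvalue of $A_0$ has negative real part; 2. for every real $\omega\ne0$ and every $\varphi\in\mathbb{R}$ the extended singular map is exponentially stable; 3. for $\omega=0$ and $\varphi=0$, i.e. for the singular map $x(T)=-A_0^{-1}A_1x(T-1)$,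 every multiplier $\mu$ satisfies $|\mu|\le1$ and $\mu\ne1$. The same equivalence holds with condition 2 replaced by: the spectral radius of $(i\omega I-A_0)^{-1}A_1$ is less than $1$ for every real $\omega\neq0$. It also holds with condition 3 replaced by: for $\omega=0$ and $\varphi=0$ the map is either exponentially stable, or neutral and such that every multiplier of the form $e^{i\theta}$, $\theta\in\mathbb{R}$, has $\theta\notin 2\pi\mathbb{Z}$. -/

import Mathlib

noncomputable section

namespace DelayStability

variable {n : ℕ}

/-- The characteristic quasipolynomial `det (λ I - A₀ - e^{-λ τ} A₁)` of the delay differential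
equation `x'(t) = A₀ x(t) + A₁ x(t - τ)`. -/
def charQuasipoly (A₀ A₁ : Matrix (Fin n) (Fin n) ℂ) (τ : ℝ) (l : ℂ) : ℂ :=
  (l • (1 : Matrix (Fin n) (Fin n) ℂ) - A₀ - Complex.exp (-l * (τ : ℂ)) • A₁).det

/-- Absolute stability of `x'(t) = A₀ x(t) + A₁ x(t - τ)`: for every delay `τ ≥ 0`, all
characteristic roots have negative real part. -/
def AbsolutelyStable (A₀ A₁ : Matrix (Fin n) (Fin n) ℂ) : Prop :=
  ∀ τ : ℝ, 0 ≤ τ → ∀ l : ℂ, charQuasipoly A₀ A₁ τ l = 0 → l.re < 0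

/-- A matrix is Hurwitz if its spectrum lies in the open left half-plane. -/
def IsHurwitz (A : Matrix (Fin n) (Fin n) ℂ) : Prop :=
  ∀ l ∈ spectrum ℂ A, l.re < 0

/-- The matrix `(iωI - A₀)⁻¹ A₁ e^{iφ}` of the extended singular map
`x(T) = (iωI - A₀)⁻¹ A₁ e^{iφ} x(T - 1)`. -/
def singularMap (A₀ A₁ : Matrix (Fin n) (Fin n) ℂ) (ω φ : ℝ) : Matrix (Fin n) (Fin n) ℂ :=
  Complex.exp (Complex.I * (φ : ℂ)) •
    ((((Complex.I * (ω : ℂ)) • (1 : Matrix (Fin n) (Fin n) ℂ) - A₀)⁻¹) * A₁)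

/-- Asymptotic exponential stability of the discrete dynamical system `x(T) = M x(T - 1)`: all
orbits decay at a uniform geometric rate. (The norm on `ℂⁿ` is immaterial; here it is the
maximum norm.) -/
def IsExpStableMap (M : Matrix (Fin n) (Fin n) ℂ) : Prop :=
  ∃ C r : ℝ, 0 ≤ r ∧ r < 1 ∧ ∀ x : ℕ → Fin n → ℂ,
    (∀ T : ℕ, x (T + 1) = M.mulVec (x T)) → ∀ T : ℕ, ‖x T‖ ≤ C * r ^ T * ‖x 0‖

/-- The multipliers of the discrete dynamical system `x(T) = M x(T - 1)`: the eigenvalues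
of `M`. -/
def multipliers (M : Matrix (Fin n) (Fin n) ℂ) : Set ℂ := spectrum ℂ M

/-- The discrete dynamical system `x(T) = M x(T - 1)` is (spectrally) neutral: no multiplier lies
outside the closed unit disc, and some multiplier lies on the unit circle. -/
def IsNeutralMap (M : Matrix (Fin n) (Fin n) ℂ) : Prop :=
  (∀ μ ∈ multipliers M, ‖μ‖ ≤ 1) ∧ ∃ μ ∈ multipliers M, ‖μ‖ = 1

end DelayStability

end

namespace DelayStability

open Filter Topology Matrix

variable {n : ℕ}

attribute [local instance] Matrix.linftyOpNormedRing Matrix.linftyOpNormedAlgebra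

/-! Everything is read off from p(λ, z) = det(λI - A₀ - zA₁). For Hurwitz A₀ the nonzero multipliers
at frequency ω are the inverses of the roots z of p(iω, ·), so the conditions on the maps say that
these roots avoid the closed disc if ω ≠ 0, and the open disc and z = 1 if ω = 0
(`NoImaginaryRoots`).

If this holds, the eigenvalues of A₀ + rzA₁, 0 ≤ r ≤ 1, cannot cross the imaginary axis when |z| < 1
or z = 1. Hence A₀ + zA₁ is Hurwitz with A₀, which rules out characteristic roots with Re λ > 0;
imaginary ones are excluded directly.

Conversely, for ω ≠ 0 the values e^{-iωτ} fill the unit circle, so absolute stability excludes |z| =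
1. To reach |z| < 1, put z = 1 - 1/u: the disc becomes Re u ≥ 1/2, and u is an eigenvalue of a
matrix continuous in s = 1/ω. At s = 0 all u vanish, and none can cross Re u = 1/2. The case ω = 0
follows by perturbing ω. -/

/-! ### Continuity of eigenvalues and connectedness -/

theorem mem_spectrum_iff_det_eq_zero {M : Matrix (Fin n) (Fin n) ℂ} {l : ℂ} :
    l ∈ spectrum ℂ M ↔ (l • (1 : Matrix (Fin n) (Fin n) ℂ) - M).det = 0 := by
  rw [Matrix.mem_spectrum_iff_isRoot_charpoly, Polynomial.IsRoot.def, Matrix.eval_charpoly,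
    Matrix.scalar_apply, Matrix.smul_one_eq_diagonal]

theorem mem_spectrum_inv_mul_iff {B C : Matrix (Fin n) (Fin n) ℂ} (hB : B.det ≠ 0) {l : ℂ} :
    l ∈ spectrum ℂ (B⁻¹ * C) ↔ (l • B - C).det = 0 := by
  have h : l • B - C = B * (l • (1 : Matrix (Fin n) (Fin n) ℂ) - B⁻¹ * C) := by
    rw [mul_sub, ← mul_assoc, Matrix.mul_nonsing_inv B (isUnit_iff_ne_zero.mpr hB), one_mul,
      Matrix.mul_smul, mul_one]
  rw [mem_spectrum_iff_det_eq_zero, h, Matrix.det_mul]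
  simp [hB]

/-- The distance from `l` to the spectrum is controlled by the characteristic polynomial at `l`. -/
theorem exists_mem_spectrum_norm_sub_lt {M : Matrix (Fin n) (Fin n) ℂ} {l : ℂ} {ε : ℝ}
    (hε : 0 < ε) (h : ‖(l • (1 : Matrix (Fin n) (Fin n) ℂ) - M).det‖ < ε ^ n) :
    ∃ m ∈ spectrum ℂ M, ‖l - m‖ < ε := by
  by_contra! hfar
  refine absurd h (not_lt.mpr ?_)
  have hs : M.charpoly.Splits := IsAlgClosed.splits _
  have hev := hs.eval_eq_prod_roots l
  rw [M.charpoly_monic.leadingCoeff, one_mul, Matrix.eval_charpoly, Matrix.scalar_apply,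
    ← Matrix.smul_one_eq_diagonal] at hev
  have hcard : M.charpoly.roots.card = n := by
    rw [← hs.natDegree_eq_card_roots, Matrix.charpoly_natDegree_eq_dim, Fintype.card_fin]
  have key : ∀ s : Multiset ℂ, (∀ m ∈ s, ε ≤ ‖l - m‖) →
      ε ^ s.card ≤ ‖(s.map fun m => l - m).prod‖ := by
    intro s
    induction s using Multiset.induction_on with
    | empty => simp
    | cons a s ih =>
      intro hs
      rw [Multiset.card_cons, Multiset.map_cons, Multiset.prod_cons, norm_mul, pow_succ']
      have h1 := hs a (Multiset.mem_cons_self a s)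
      have h2 := ih fun m hm => hs m (Multiset.mem_cons_of_mem hm)
      gcongr
  have := key M.charpoly.roots fun m hm => hfar m <|
    Matrix.mem_spectrum_iff_isRoot_charpoly.mpr (Polynomial.isRoot_of_mem_roots hm)
  rwa [hcard, ← hev] at this

/-- Eigenvalues persist under small perturbations of the matrix. -/
theorem eventually_exists_mem_spectrum {X : Type*} [TopologicalSpace X]
    {M : X → Matrix (Fin n) (Fin n) ℂ} {x₀ : X} (hM : ContinuousAt M x₀) {l : ℂ}
    (hl : l ∈ spectrum ℂ (M x₀)) {ε : ℝ} (hε : 0 < ε) :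
    ∀ᶠ x in 𝓝 x₀, ∃ m ∈ spectrum ℂ (M x), ‖l - m‖ < ε := by
  have hdet : Continuous fun A : Matrix (Fin n) (Fin n) ℂ =>
      ‖(l • (1 : Matrix (Fin n) (Fin n) ℂ) - A).det‖ :=
    ((continuous_const.sub continuous_id).matrix_det).norm
  have ht : ContinuousAt (fun x => ‖(l • (1 : Matrix (Fin n) (Fin n) ℂ) - M x).det‖) x₀ :=
    hdet.continuousAt.comp hM
  have h0 : ‖(l • (1 : Matrix (Fin n) (Fin n) ℂ) - M x₀).det‖ < ε ^ n := by
    rw [mem_spectrum_iff_det_eq_zero.mp hl, norm_zero]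
    positivity
  exact (ht.eventually (gt_mem_nhds h0)).mono fun x hx => exists_mem_spectrum_norm_sub_lt hε hx

/-- Nearby matrices have their eigenvalues in a common disc, so only a compact half-disc must be
kept free of them; there nonvanishing of the determinant is stable. -/
theorem eventually_isHurwitz {X : Type*} [TopologicalSpace X]
    {M : X → Matrix (Fin n) (Fin n) ℂ} (hM : Continuous M) {x₀ : X} (h : IsHurwitz (M x₀)) :
    ∀ᶠ x in 𝓝 x₀, IsHurwitz (M x) := by
  -- The factor `‖1‖` covers n = 0, where the identity has norm 0.
  set R : ℝ := ‖M x₀‖ * ‖(1 : Matrix (Fin n) (Fin n) ℂ)‖ + 1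
  have hK : IsCompact (Metric.closedBall (0 : ℂ) R ∩ {l : ℂ | 0 ≤ l.re}) :=
    (isCompact_closedBall 0 R).inter_right (isClosed_le continuous_const Complex.continuous_re)
  have hn : ∀ᶠ x in 𝓝 x₀, ‖M x‖ * ‖(1 : Matrix (Fin n) (Fin n) ℂ)‖ < R := by
    have hc : Continuous fun x => ‖M x‖ * ‖(1 : Matrix (Fin n) (Fin n) ℂ)‖ :=
      (continuous_norm.comp hM).mul continuous_const
    exact hc.continuousAt.eventually (gt_mem_nhds (lt_add_one _))
  have hd : Continuous fun p : X × ℂ =>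
      (p.2 • (1 : Matrix (Fin n) (Fin n) ℂ) - M p.1).det :=
    ((continuous_snd.smul continuous_const).sub (hM.comp continuous_fst)).matrix_det
  have hne : ∀ᶠ x in 𝓝 x₀, ∀ l ∈ Metric.closedBall (0 : ℂ) R ∩ {l : ℂ | 0 ≤ l.re},
      (l • (1 : Matrix (Fin n) (Fin n) ℂ) - M x).det ≠ 0 := by
    refine hK.eventually_forall_of_forall_eventually fun l hl => ?_
    refine hd.continuousAt.eventually_ne fun h0 => ?_
    exact absurd (h l (mem_spectrum_iff_det_eq_zero.mpr h0)) (not_lt.mpr hl.2)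
  filter_upwards [hn, hne] with x hx1 hx2 l hl
  by_contra! hre
  refine hx2 l ⟨?_, hre⟩ (mem_spectrum_iff_det_eq_zero.mp hl)
  rw [mem_closedBall_zero_iff]
  exact (spectrum.norm_le_norm_mul_of_mem hl).trans hx1.le

/-- Along a connected family of matrices without eigenvalues on the imaginary axis, being Hurwitz
at one parameter implies being Hurwitz at all parameters. -/
theorem isHurwitz_of_connected {X : Type*} [TopologicalSpace X] [PreconnectedSpace X]
    {M : X → Matrix (Fin n) (Fin n) ℂ} (hM : Continuous M)
    (hre : ∀ x, ∀ l ∈ spectrum ℂ (M x), l.re ≠ 0) {x₀ : X} (h₀ : IsHurwitz (M x₀)) (x : X) :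
    IsHurwitz (M x) := by
  have hclopen : IsClopen {x | IsHurwitz (M x)} := by
    refine ⟨⟨?_⟩, isOpen_iff_mem_nhds.mpr fun y hy => eventually_isHurwitz hM hy⟩
    refine isOpen_iff_mem_nhds.mpr fun y hy => ?_
    obtain ⟨l, hl, hl0⟩ : ∃ l ∈ spectrum ℂ (M y), 0 ≤ l.re := by
      simpa [IsHurwitz] using hy
    -- The disc of radius Re l about l lies in the right half-plane, so the unstable eigenvalue
    -- persists.
    have hpos : 0 < l.re := lt_of_le_of_ne hl0 (hre y l hl).symm
    filter_upwards [eventually_exists_mem_spectrum hM.continuousAt hl hpos] with z hz hH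
    obtain ⟨m, hm, hlm⟩ := hz
    have h1 := hH m hm
    have h2 := (Complex.abs_re_le_norm (l - m)).trans_lt hlm
    rw [Complex.sub_re] at h2
    linarith [le_abs_self (l.re - m.re)]
  exact Set.eq_univ_iff_forall.mp (hclopen.eq_univ ⟨x₀, h₀⟩) x

/-! ### Exponential stability and the spectrum -/

theorem spectralRadius_lt_one_iff {M : Matrix (Fin n) (Fin n) ℂ} :
    spectralRadius ℂ M < 1 ↔ ∀ l ∈ spectrum ℂ M, ‖l‖ < 1 := by
  constructor
  · intro h l hl
    have : (‖l‖₊ : ENNReal) < 1 := (le_iSup₂ (f := fun k (_ : k ∈ spectrum ℂ M) =>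
      (‖k‖₊ : ENNReal)) l hl).trans_lt h
    exact_mod_cast this
  · intro h
    rcases (spectrum ℂ M).eq_empty_or_nonempty with he | hne
    · simp [spectralRadius, he]
    · exact spectrum.spectralRadius_lt_of_forall_lt_of_nonempty hne (r := 1)
        fun k hk => by exact_mod_cast h k hk

/-- Orbits of eigenvectors give necessity; Gelfand's formula gives a geometric bound on the powers
of M. -/
theorem isExpStableMap_iff {M : Matrix (Fin n) (Fin n) ℂ} :
    IsExpStableMap M ↔ ∀ l ∈ spectrum ℂ M, ‖l‖ < 1 := by
  constructor
  · rintro ⟨C, r, hr0, hr1, h⟩ l hl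
    obtain ⟨v, hv, hMv⟩ :=
      Matrix.exists_mulVec_eq_zero_iff.mpr (mem_spectrum_iff_det_eq_zero.mp hl)
    have hMv' : M *ᵥ v = l • v := by
      rw [Matrix.sub_mulVec, Matrix.smul_mulVec, Matrix.one_mulVec, sub_eq_zero] at hMv
      exact hMv.symm
    have hb : ∀ T : ℕ, ‖l‖ ^ T ≤ C * r ^ T := by
      intro T
      have := h (fun T => l ^ T • v)
        (fun T => by rw [Matrix.mulVec_smul, hMv', smul_smul, pow_succ]) T
      simp only [norm_smul, norm_pow, pow_zero, one_smul] at this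
      exact le_of_mul_le_mul_right this (norm_pos_iff.mpr hv)
    by_contra! hl1
    have ht : Tendsto (fun T : ℕ => C * r ^ T) atTop (𝓝 0) := by
      simpa using (tendsto_pow_atTop_nhds_zero_of_lt_one hr0 hr1).const_mul C
    obtain ⟨T, hT⟩ := (ht.eventually (gt_mem_nhds one_pos)).exists
    exact absurd ((one_le_pow₀ hl1).trans (hb T)) (not_le.mpr hT)
  · intro h
    obtain ⟨r, hr, hr1⟩ := ENNReal.lt_iff_exists_nnreal_btwn.mp (spectralRadius_lt_one_iff.mpr h)
    have hr0 : 0 < (r : ℝ) := by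
      have : (0 : ENNReal) < r := bot_le.trans_lt hr
      exact_mod_cast this
    have hpow : (fun T : ℕ => M ^ T) =O[atTop] fun T => (r : ℝ) ^ T := by
      refine Asymptotics.IsBigO.of_bound 1 ?_
      filter_upwards [(spectrum.pow_nnnorm_pow_one_div_tendsto_nhds_spectralRadius M).eventually
        (gt_mem_nhds hr), eventually_gt_atTop 0] with T hT hT0
      rw [one_div, ENNReal.rpow_inv_lt_iff (by exact_mod_cast hT0), ENNReal.rpow_natCast] at hT
      have : ‖M ^ T‖₊ < r ^ T := by exact_mod_cast hT
      have : ‖M ^ T‖ < (r : ℝ) ^ T := by exact_mod_cast this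
      rw [one_mul, Real.norm_of_nonneg (pow_pos hr0 T).le]
      exact this.le
    obtain ⟨C, -, hC⟩ := Asymptotics.bound_of_isBigO_nat_atTop hpow
    refine ⟨C, r, hr0.le, by exact_mod_cast hr1, fun x hx T => ?_⟩
    have horb : x T = M ^ T *ᵥ x 0 := by
      induction T with
      | zero => simp
      | succ T ih => rw [hx, ih, Matrix.mulVec_mulVec, pow_succ']
    have hCT := hC (pow_ne_zero T hr0.ne')
    rw [Real.norm_of_nonneg (pow_pos hr0 T).le] at hCT
    rw [horb]
    exact (Matrix.linfty_opNorm_mulVec _ _).trans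
      (mul_le_mul_of_nonneg_right hCT (norm_nonneg _))

/-! ### The pencil and the Möbius substitution -/

/-- The two-variable polynomial `det (λ I - A₀ - z A₁)`. -/
def charPencil (A₀ A₁ : Matrix (Fin n) (Fin n) ℂ) (l z : ℂ) : ℂ :=
  (l • (1 : Matrix (Fin n) (Fin n) ℂ) - A₀ - z • A₁).det

theorem charQuasipoly_eq_charPencil (A₀ A₁ : Matrix (Fin n) (Fin n) ℂ) (τ : ℝ) (l : ℂ) :
    charQuasipoly A₀ A₁ τ l = charPencil A₀ A₁ l (Complex.exp (-l * (τ : ℂ))) := rfl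

theorem mem_spectrum_add_smul_iff {A₀ A₁ : Matrix (Fin n) (Fin n) ℂ} {l z : ℂ} :
    l ∈ spectrum ℂ (A₀ + z • A₁) ↔ charPencil A₀ A₁ l z = 0 := by
  rw [mem_spectrum_iff_det_eq_zero, charPencil, sub_sub]

theorem continuous_matrix_inv {X : Type*} [TopologicalSpace X]
    {B : X → Matrix (Fin n) (Fin n) ℂ} (hB : Continuous B) (hdet : ∀ x, (B x).det ≠ 0) :
    Continuous fun x => (B x)⁻¹ := by
  simp only [Matrix.inv_def, Ring.inverse_eq_inv']
  exact (hB.matrix_det.inv₀ hdet).smul hB.matrix_adjugate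

theorem norm_one_sub_inv_sq {u : ℂ} (hu : u ≠ 0) :
    ‖1 - u⁻¹‖ ^ 2 = 1 - (2 * u.re - 1) / ‖u‖ ^ 2 := by
  have h0 : ‖u‖ ^ 2 ≠ 0 := pow_ne_zero 2 (norm_ne_zero_iff.mpr hu)
  have h1 : 1 - u⁻¹ = (u - 1) / u := by field_simp
  have h2 : ‖u - 1‖ ^ 2 = ‖u‖ ^ 2 - (2 * u.re - 1) := by
    rw [Complex.sq_norm, Complex.sq_norm, Complex.normSq_apply, Complex.normSq_apply]
    simp only [Complex.sub_re, Complex.sub_im, Complex.one_re, Complex.one_im]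
    ring
  rw [h1, norm_div, div_pow, h2, sub_div, div_self h0]

theorem norm_one_sub_inv_le_one_iff {u : ℂ} (hu : u ≠ 0) : ‖1 - u⁻¹‖ ≤ 1 ↔ 1 / 2 ≤ u.re := by
  have h0 : 0 < ‖u‖ ^ 2 := pow_pos (norm_pos_iff.mpr hu) 2
  rw [← sq_le_one_iff₀ (norm_nonneg _), norm_one_sub_inv_sq hu, sub_le_self_iff,
    le_div_iff₀ h0, zero_mul]
  constructor <;> intro h <;> linarith

theorem norm_one_sub_inv_lt_one_iff {u : ℂ} (hu : u ≠ 0) : ‖1 - u⁻¹‖ < 1 ↔ 1 / 2 < u.re := by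
  have h0 : 0 < ‖u‖ ^ 2 := pow_pos (norm_pos_iff.mpr hu) 2
  rw [← sq_lt_one_iff₀ (norm_nonneg _), norm_one_sub_inv_sq hu, sub_lt_self_iff,
    div_pos_iff_of_pos_right h0]
  constructor <;> intro h <;> linarith

/-- The Möbius change of variable `z = 1 - u⁻¹` in `det (λ I - A₀ - z A₁)`. -/
theorem det_smul_add_eq_charPencil (A₀ A₁ : Matrix (Fin n) (Fin n) ℂ) (a : ℂ) {b u : ℂ}
    (hb : b ≠ 0) (hu : u ≠ 0) :
    (u • (a • (1 : Matrix (Fin n) (Fin n) ℂ) - b • (A₀ + A₁)) + b • A₁).det =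
      (u * b) ^ n * charPencil A₀ A₁ (a * b⁻¹) (1 - u⁻¹) := by
  have h : u • (a • (1 : Matrix (Fin n) (Fin n) ℂ) - b • (A₀ + A₁)) + b • A₁ =
      (u * b) • ((a * b⁻¹) • (1 : Matrix (Fin n) (Fin n) ℂ) - A₀ - (1 - u⁻¹) • A₁) := by
    have h1 : u * b * (a * b⁻¹) = u * a := by field_simp
    have h2 : u * b * (1 - u⁻¹) = u * b - b := by field_simp
    rw [smul_sub (u * b), smul_sub (u * b), smul_smul, smul_smul, h1, h2, sub_smul]
    simp only [smul_sub, smul_add, smul_smul]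
    abel
  rw [h, Matrix.det_smul, Fintype.card_fin, charPencil]

theorem exists_delay_exp_eq {ω : ℝ} (hω : ω ≠ 0) {z : ℂ} (hz : ‖z‖ = 1) :
    ∃ τ : ℝ, 0 ≤ τ ∧ Complex.exp (-(Complex.I * (ω : ℂ)) * (τ : ℂ)) = z := by
  have hzexp : Complex.exp (z.arg * Complex.I) = z := by
    simpa [hz] using Complex.norm_mul_exp_arg_mul_I z
  have hωc : (ω : ℂ) ≠ 0 := Complex.ofReal_ne_zero.mpr hω
  have h1 := Complex.neg_pi_lt_arg z
  have h2 := Complex.arg_le_pi z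
  have h3 := Real.pi_pos
  rcases lt_or_gt_of_ne hω with h | h
  -- A shift of the argument by 2π, with sign chosen by that of ω, makes the delay nonnegative.
  · refine ⟨(-(2 * Real.pi) - z.arg) / ω, div_nonneg_of_nonpos (by linarith) h.le, ?_⟩
    refine Eq.trans ?_ ((Complex.exp_periodic (z.arg * Complex.I)).trans hzexp)
    congr 1
    push_cast
    field_simp
    ring
  · refine ⟨(2 * Real.pi - z.arg) / ω, div_nonneg (by linarith) h.le, ?_⟩
    refine Eq.trans ?_ ((Complex.exp_periodic.sub_eq (z.arg * Complex.I)).trans hzexp)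
    congr 1
    push_cast
    field_simp
    ring

/-! ### Absolute stability and imaginary roots -/

/-- `det (λ I - A₀ - z A₁)` has no root with `λ` imaginary and `z` in the closed unit disc, except
possibly for `λ = 0` and `z ≠ 1` on the unit circle. -/
structure NoImaginaryRoots (A₀ A₁ : Matrix (Fin n) (Fin n) ℂ) : Prop where
  of_ne_zero : ∀ ω : ℝ, ω ≠ 0 → ∀ z : ℂ, ‖z‖ ≤ 1 → charPencil A₀ A₁ (Complex.I * ω) z ≠ 0
  of_lt_one : ∀ z : ℂ, ‖z‖ < 1 → charPencil A₀ A₁ 0 z ≠ 0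
  at_one : charPencil A₀ A₁ 0 1 ≠ 0

theorem AbsolutelyStable.charPencil_one_ne_zero {A₀ A₁ : Matrix (Fin n) (Fin n) ℂ}
    (h : AbsolutelyStable A₀ A₁) {l : ℂ} (hl : 0 ≤ l.re) : charPencil A₀ A₁ l 1 ≠ 0 := by
  intro h0
  refine absurd (h 0 le_rfl l ?_) (not_lt.mpr hl)
  rw [charQuasipoly_eq_charPencil]
  simpa using h0

theorem AbsolutelyStable.charPencil_ne_zero_of_norm_eq_one {A₀ A₁ : Matrix (Fin n) (Fin n) ℂ}
    (h : AbsolutelyStable A₀ A₁) {ω : ℝ} (hω : ω ≠ 0) {z : ℂ} (hz : ‖z‖ = 1) :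
    charPencil A₀ A₁ (Complex.I * ω) z ≠ 0 := by
  intro h0
  obtain ⟨τ, hτ, rfl⟩ := exists_delay_exp_eq hω hz
  simpa using h τ hτ (Complex.I * ω) h0

theorem AbsolutelyStable.charPencil_ne_zero_of_norm_le_one {A₀ A₁ : Matrix (Fin n) (Fin n) ℂ}
    (h : AbsolutelyStable A₀ A₁) {ω : ℝ} (hω : ω ≠ 0) {z : ℂ} (hz : ‖z‖ ≤ 1) :
    charPencil A₀ A₁ (Complex.I * ω) z ≠ 0 := by
  intro h0
  -- Here s stands for 1/ω, so s = 0 is ω = ∞. Stability at τ = 0 excludes z = 1, that is u = ∞, and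
  -- makes B s invertible.
  let B : ℝ → Matrix (Fin n) (Fin n) ℂ := fun s =>
    Complex.I • (1 : Matrix (Fin n) (Fin n) ℂ) - (s : ℂ) • (A₀ + A₁)
  -- The term with 1/2 shifts the eigenvalues to u - 1/2, moving the critical line Re u = 1/2 onto
  -- the imaginary axis.
  let C : ℝ → Matrix (Fin n) (Fin n) ℂ := fun s => -((s : ℂ) • A₁) - (1 / 2 : ℂ) • B s
  have hBc : Continuous B :=
    continuous_const.sub (Complex.continuous_ofReal.smul continuous_const)
  have hCc : Continuous C :=
    (Complex.continuous_ofReal.smul continuous_const).neg.sub (hBc.const_smul (1 / 2 : ℂ))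
  have hBdet : ∀ s, (B s).det ≠ 0 := by
    intro s hs
    by_cases hs0 : s = 0
    · simp [B, hs0] at hs
    · have hsc : (s : ℂ) ≠ 0 := Complex.ofReal_ne_zero.mpr hs0
      have hB : B s = (s : ℂ) • ((Complex.I * (s⁻¹ : ℝ)) • (1 : Matrix (Fin n) (Fin n) ℂ) - A₀ -
          (1 : ℂ) • A₁) := by
        have h1 : (s : ℂ) * (Complex.I * (s⁻¹ : ℝ)) = Complex.I := by
          push_cast
          field_simp
        simp only [B, smul_sub, smul_add, smul_smul, h1, mul_one]
        abel
      rw [hB, Matrix.det_smul] at hs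
      exact h.charPencil_one_ne_zero (l := Complex.I * (s⁻¹ : ℝ)) (by simp)
        ((mul_eq_zero.mp hs).resolve_left (pow_ne_zero _ hsc))
  have hspec : ∀ (s : ℝ) (l : ℂ), l ∈ spectrum ℂ ((B s)⁻¹ * C s) ↔
      ((l + 1 / 2) • B s + (s : ℂ) • A₁).det = 0 := by
    intro s l
    rw [mem_spectrum_inv_mul_iff (hBdet s)]
    have : l • B s - C s = (l + 1 / 2) • B s + (s : ℂ) • A₁ := by
      simp only [C, add_smul]
      abel
    rw [this]
  have hH : ∀ s, IsHurwitz ((B s)⁻¹ * C s) := by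
    have hzero : ∀ l ∈ spectrum ℂ ((B 0)⁻¹ * C 0), l.re = -(1 / 2) := by
      intro l hl
      rw [hspec] at hl
      have hl' : (l + 1 / 2) * Complex.I = 0 := by
        simp only [B, Complex.ofReal_zero, zero_smul, sub_zero, add_zero, smul_smul,
          Matrix.det_smul, Matrix.det_one, mul_one] at hl
        exact eq_zero_of_pow_eq_zero hl
      have := (mul_eq_zero.mp hl').resolve_right Complex.I_ne_zero
      rw [eq_neg_of_add_eq_zero_left this]
      norm_num
    refine isHurwitz_of_connected ((continuous_matrix_inv hBc hBdet).mul hCc) ?_ (x₀ := 0) ?_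
    · intro s l hl hre
      by_cases hs0 : s = 0
      · subst hs0
        rw [hzero l hl] at hre
        norm_num at hre
      · have hsc : (s : ℂ) ≠ 0 := Complex.ofReal_ne_zero.mpr hs0
        have hure : (l + 1 / 2).re = 1 / 2 := by simp [hre]
        have hu : l + 1 / 2 ≠ 0 := fun hu => by
          rw [hu] at hure
          norm_num at hure
        rw [hspec, det_smul_add_eq_charPencil A₀ A₁ _ hsc hu, mul_eq_zero,
          or_iff_right (pow_ne_zero _ (mul_ne_zero hu hsc)), ← Complex.ofReal_inv] at hl
        refine h.charPencil_ne_zero_of_norm_eq_one (inv_ne_zero hs0) ?_ hl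
        refine le_antisymm ((norm_one_sub_inv_le_one_iff hu).mpr hure.ge) (not_lt.mp fun hlt => ?_)
        exact ((norm_one_sub_inv_lt_one_iff hu).mp hlt).ne' hure
    · intro l hl
      rw [hzero l hl]
      norm_num
  have hz1 : 1 - z ≠ 0 := by
    intro hz1
    rw [← sub_eq_zero.mp hz1] at h0
    exact h.charPencil_one_ne_zero (by simp) h0
  have hu : (1 - z)⁻¹ ≠ 0 := inv_ne_zero hz1
  have hzu : z = 1 - ((1 - z)⁻¹)⁻¹ := by simp
  have hmem : (1 - z)⁻¹ - 1 / 2 ∈ spectrum ℂ ((B ω⁻¹)⁻¹ * C ω⁻¹) := by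
    rw [hspec, sub_add_cancel, det_smul_add_eq_charPencil A₀ A₁ _
      (Complex.ofReal_ne_zero.mpr (inv_ne_zero hω)) hu, ← hzu, Complex.ofReal_inv, inv_inv, h0,
      mul_zero]
  have hneg := hH ω⁻¹ _ hmem
  rw [hzu] at hz
  have := (norm_one_sub_inv_le_one_iff hu).mp hz
  have h12 : (1 / 2 : ℂ).re = 1 / 2 := by norm_num
  rw [Complex.sub_re, h12] at hneg
  linarith

/-- No delay reaches z at λ = 0, but a root in the open disc would persist for small ω ≠ 0, where it
is excluded. -/
theorem AbsolutelyStable.charPencil_zero_ne_zero {A₀ A₁ : Matrix (Fin n) (Fin n) ℂ}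
    (h : AbsolutelyStable A₀ A₁) {z : ℂ} (hz : ‖z‖ < 1) : charPencil A₀ A₁ 0 z ≠ 0 := by
  intro h0
  let B : ℝ → Matrix (Fin n) (Fin n) ℂ := fun ω =>
    (Complex.I * ω) • (1 : Matrix (Fin n) (Fin n) ℂ) - (1 : ℂ) • (A₀ + A₁)
  have hBc : Continuous B :=
    ((continuous_const.mul Complex.continuous_ofReal).smul continuous_const).sub continuous_const
  have hBdet : ∀ ω, (B ω).det ≠ 0 := by
    intro ω
    have := h.charPencil_one_ne_zero (l := Complex.I * ω) (by simp)
    simpa only [charPencil, B, one_smul, sub_sub] using this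
  have hspec : ∀ (ω : ℝ) {u : ℂ}, u ≠ 0 → (u ∈ spectrum ℂ ((B ω)⁻¹ * -A₁) ↔
      charPencil A₀ A₁ (Complex.I * ω) (1 - u⁻¹) = 0) := by
    intro ω u hu
    have hd := det_smul_add_eq_charPencil A₀ A₁ (Complex.I * ω) one_ne_zero hu
    rw [one_smul ℂ A₁, inv_one, mul_one, mul_one] at hd
    rw [mem_spectrum_inv_mul_iff (hBdet ω), sub_neg_eq_add, hd, mul_eq_zero,
      or_iff_right (pow_ne_zero _ hu)]
  have hz1 : 1 - z ≠ 0 := by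
    intro hz1
    rw [← sub_eq_zero.mp hz1, norm_one] at hz
    exact lt_irrefl _ hz
  have hu : (1 - z)⁻¹ ≠ 0 := inv_ne_zero hz1
  have hzu : z = 1 - ((1 - z)⁻¹)⁻¹ := by simp
  have hmem : (1 - z)⁻¹ ∈ spectrum ℂ ((B 0)⁻¹ * -A₁) := by
    rw [hspec 0 hu, ← hzu, Complex.ofReal_zero, mul_zero, h0]
  have hre : 1 / 2 < ((1 - z)⁻¹).re := by
    rw [hzu] at hz
    exact (norm_one_sub_inv_lt_one_iff hu).mp hz
  have hev := eventually_exists_mem_spectrum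
    ((continuous_matrix_inv hBc hBdet).mul continuous_const).continuousAt hmem (sub_pos.mpr hre)
  obtain ⟨ω, ⟨m, hm, hdist⟩, hω⟩ :=
    ((hev.filter_mono nhdsWithin_le_nhds).and (self_mem_nhdsWithin : {(0 : ℝ)}ᶜ ∈ 𝓝[≠] 0)).exists
  have hmre : 1 / 2 < m.re := by
    have h2 := (Complex.abs_re_le_norm ((1 - z)⁻¹ - m)).trans_lt hdist
    have h3 := (le_abs_self _).trans_lt h2
    rw [Complex.sub_re] at h3
    linarith
  have hm0 : m ≠ 0 := by
    rintro rfl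
    norm_num at hmre
  exact h.charPencil_ne_zero_of_norm_le_one hω ((norm_one_sub_inv_lt_one_iff hm0).mpr hmre).le
    ((hspec ω hm0).mp hm)

theorem AbsolutelyStable.noImaginaryRoots {A₀ A₁ : Matrix (Fin n) (Fin n) ℂ}
    (h : AbsolutelyStable A₀ A₁) : NoImaginaryRoots A₀ A₁ where
  of_ne_zero _ hω _ hz := h.charPencil_ne_zero_of_norm_le_one hω hz
  of_lt_one _ hz := h.charPencil_zero_ne_zero hz
  at_one := h.charPencil_one_ne_zero (by simp)

/-- Along the segment from A₀ to A₀ + zA₁ no eigenvalue meets the imaginary axis. -/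
theorem NoImaginaryRoots.isHurwitz_iff {A₀ A₁ : Matrix (Fin n) (Fin n) ℂ}
    (h : NoImaginaryRoots A₀ A₁) {z : ℂ} (hz : ‖z‖ < 1 ∨ z = 1) :
    IsHurwitz (A₀ + z • A₁) ↔ IsHurwitz A₀ := by
  let M : unitInterval → Matrix (Fin n) (Fin n) ℂ := fun r => A₀ + (((r : ℝ) : ℂ) * z) • A₁
  have hM : Continuous M := continuous_const.add
    (((Complex.continuous_ofReal.comp continuous_subtype_val).mul continuous_const).smul
      continuous_const)
  have hre : ∀ r, ∀ l ∈ spectrum ℂ (M r), l.re ≠ 0 := by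
    intro r l hl hl0
    have hl' : l = Complex.I * (l.im : ℂ) := by
      apply Complex.ext <;> simp [hl0]
    rw [mem_spectrum_add_smul_iff] at hl
    have hnorm : ‖((r : ℝ) : ℂ) * z‖ = r * ‖z‖ := by
      rw [norm_mul, Complex.norm_real, Real.norm_of_nonneg r.2.1]
    have hz1 : ‖z‖ ≤ 1 := hz.elim le_of_lt fun h => by simp [h]
    by_cases hω : l.im = 0
    · rw [hl', hω, Complex.ofReal_zero, mul_zero] at hl
      -- At λ = 0 the unit circle is reached only at this endpoint; otherwise |rz| < 1.
      by_cases hr : (r : ℝ) = 1 ∧ z = 1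
      · rw [hr.1, hr.2, Complex.ofReal_one, one_mul] at hl
        exact h.at_one hl
      · refine h.of_lt_one _ ?_ hl
        rw [hnorm]
        rcases hz with hz | rfl
        · exact (mul_le_of_le_one_left (norm_nonneg z) r.2.2).trans_lt hz
        · simpa using lt_of_le_of_ne r.2.2 fun h => hr ⟨h, rfl⟩
    · rw [hl'] at hl
      refine h.of_ne_zero _ hω _ ?_ hl
      rw [hnorm]
      exact mul_le_one₀ r.2.2 (norm_nonneg z) hz1
  have h0 : M 0 = A₀ := by simp [M]
  have h1 : M 1 = A₀ + z • A₁ := by simp [M]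
  constructor
  · intro hH
    rw [← h1] at hH
    exact h0 ▸ isHurwitz_of_connected hM hre hH 0
  · intro hH
    rw [← h0] at hH
    exact h1 ▸ isHurwitz_of_connected hM hre hH 1

theorem absolutelyStable_iff_noImaginaryRoots {A₀ A₁ : Matrix (Fin n) (Fin n) ℂ} :
    AbsolutelyStable A₀ A₁ ↔ IsHurwitz A₀ ∧ NoImaginaryRoots A₀ A₁ := by
  constructor
  · intro h
    refine ⟨(h.noImaginaryRoots.isHurwitz_iff (Or.inr rfl)).mp fun l hl => ?_, h.noImaginaryRoots⟩
    by_contra! hre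
    exact h.charPencil_one_ne_zero hre (mem_spectrum_add_smul_iff.mp hl)
  · rintro ⟨hA, h⟩ τ hτ l hl
    rw [charQuasipoly_eq_charPencil] at hl
    by_contra! hre
    have hnorm : ‖Complex.exp (-l * (τ : ℂ))‖ = Real.exp (-(l.re * τ)) := by
      simp [Complex.norm_exp]
    rcases hre.eq_or_lt with h0 | hpos
    · have hl' : l = Complex.I * (l.im : ℂ) := by
        apply Complex.ext <;> simp [← h0]
      by_cases hω : l.im = 0
      · rw [hω, Complex.ofReal_zero, mul_zero] at hl'
        subst hl'
        exact h.at_one (by simpa using hl)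
      · refine h.of_ne_zero _ hω (Complex.exp (-l * (τ : ℂ))) ?_ (by rwa [← hl'])
        rw [hnorm, ← h0, zero_mul, neg_zero, Real.exp_zero]
    · have hz : ‖Complex.exp (-l * (τ : ℂ))‖ < 1 ∨ Complex.exp (-l * (τ : ℂ)) = 1 := by
        rcases hτ.eq_or_lt with rfl | hτ
        · right
          simp
        · left
          rw [hnorm, Real.exp_lt_one_iff]
          exact neg_neg_of_pos (mul_pos hpos hτ)
      exact absurd ((h.isHurwitz_iff hz).mpr hA l (mem_spectrum_add_smul_iff.mpr hl))
        (not_lt.mpr hre)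

/-! ### Translation into multipliers -/

/-- For Hurwitz `A₀` the multipliers of the extended singular map are the inverses of the roots
`z` of `det (iω I - A₀ - z A₁)`. -/
theorem mem_spectrum_singular_iff {A₀ A₁ : Matrix (Fin n) (Fin n) ℂ} (hA : IsHurwitz A₀) (ω : ℝ)
    {m : ℂ} (hm : m ≠ 0) :
    m ∈ spectrum ℂ (((Complex.I * (ω : ℂ)) • (1 : Matrix (Fin n) (Fin n) ℂ) - A₀)⁻¹ * A₁) ↔
      charPencil A₀ A₁ (Complex.I * ω) m⁻¹ = 0 := by
  have hdet : ((Complex.I * (ω : ℂ)) • (1 : Matrix (Fin n) (Fin n) ℂ) - A₀).det ≠ 0 := by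
    intro h0
    simpa using hA _ (mem_spectrum_iff_det_eq_zero.mpr h0)
  have h : ∀ B : Matrix (Fin n) (Fin n) ℂ, m • B - A₁ = m • (B - m⁻¹ • A₁) := fun B => by
    rw [smul_sub, smul_smul, mul_inv_cancel₀ hm, one_smul]
  rw [mem_spectrum_inv_mul_iff hdet, h, Matrix.det_smul, mul_eq_zero,
    or_iff_right (pow_ne_zero _ hm), charPencil]

theorem charPencil_zero_right_ne_zero {A₀ : Matrix (Fin n) (Fin n) ℂ} (hA : IsHurwitz A₀)
    (A₁ : Matrix (Fin n) (Fin n) ℂ) (ω : ℝ) : charPencil A₀ A₁ (Complex.I * ω) 0 ≠ 0 := by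
  intro h0
  rw [charPencil, zero_smul, sub_zero] at h0
  simpa using hA _ (mem_spectrum_iff_det_eq_zero.mpr h0)

theorem singularMap_zero (A₀ A₁ : Matrix (Fin n) (Fin n) ℂ) (ω : ℝ) :
    singularMap A₀ A₁ ω 0 =
      ((Complex.I * (ω : ℂ)) • (1 : Matrix (Fin n) (Fin n) ℂ) - A₀)⁻¹ * A₁ := by
  simp [singularMap]

theorem noImaginaryRoots_iff {A₀ A₁ : Matrix (Fin n) (Fin n) ℂ} (hA : IsHurwitz A₀) :
    NoImaginaryRoots A₀ A₁ ↔
      (∀ ω : ℝ, ω ≠ 0 → ∀ m ∈ spectrum ℂ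
        (((Complex.I * (ω : ℂ)) • (1 : Matrix (Fin n) (Fin n) ℂ) - A₀)⁻¹ * A₁), ‖m‖ < 1) ∧
      ∀ m ∈ multipliers (singularMap A₀ A₁ 0 0), ‖m‖ ≤ 1 ∧ m ≠ 1 := by
  have hzero : ∀ {m : ℂ}, m ≠ 0 → (m ∈ multipliers (singularMap A₀ A₁ 0 0) ↔
      charPencil A₀ A₁ 0 m⁻¹ = 0) := by
    intro m hm
    rw [multipliers, singularMap_zero, mem_spectrum_singular_iff hA 0 hm, Complex.ofReal_zero,
      mul_zero]
  constructor
  · intro h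
    refine ⟨fun ω hω m hm => ?_, fun m hm => ⟨?_, ?_⟩⟩
    · by_contra! hm1
      have hm0 : m ≠ 0 := norm_pos_iff.mp (one_pos.trans_le hm1)
      refine h.of_ne_zero ω hω m⁻¹ ?_ ((mem_spectrum_singular_iff hA ω hm0).mp hm)
      rw [norm_inv]
      exact inv_le_one_of_one_le₀ hm1
    · by_contra! hm1
      have hm0 : m ≠ 0 := norm_pos_iff.mp (one_pos.trans hm1)
      refine h.of_lt_one m⁻¹ ?_ ((hzero hm0).mp hm)
      rw [norm_inv]
      exact inv_lt_one_of_one_lt₀ hm1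
    · rintro rfl
      exact h.at_one (by simpa using (hzero one_ne_zero).mp hm)
  · rintro ⟨h2, h3⟩
    refine ⟨fun ω hω z hz h0 => ?_, fun z hz h0 => ?_, fun h0 => ?_⟩
    · have hz0 : z ≠ 0 := by
        rintro rfl
        exact charPencil_zero_right_ne_zero hA A₁ ω h0
      have := h2 ω hω z⁻¹ ((mem_spectrum_singular_iff hA ω (inv_ne_zero hz0)).mpr
        (by rwa [inv_inv]))
      rw [norm_inv] at this
      exact absurd this (not_lt.mpr ((one_le_inv₀ (norm_pos_iff.mpr hz0)).mpr hz))
    · have hz0 : z ≠ 0 := by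
        rintro rfl
        exact charPencil_zero_right_ne_zero hA A₁ 0 (by simpa using h0)
      have := (h3 z⁻¹ ((hzero (inv_ne_zero hz0)).mpr (by rwa [inv_inv]))).1
      rw [norm_inv] at this
      exact absurd this (not_le.mpr ((one_lt_inv₀ (norm_pos_iff.mpr hz0)).mpr hz))
    · exact (h3 1 ((hzero one_ne_zero).mpr (by rwa [inv_one]))).2 rfl

/-- The phase only rotates the spectrum, so φ = 0 decides all φ. -/
theorem forall_isExpStableMap_singularMap_iff {A₀ A₁ : Matrix (Fin n) (Fin n) ℂ} (ω : ℝ) :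
    (∀ φ : ℝ, IsExpStableMap (singularMap A₀ A₁ ω φ)) ↔ ∀ m ∈ spectrum ℂ
      (((Complex.I * (ω : ℂ)) • (1 : Matrix (Fin n) (Fin n) ℂ) - A₀)⁻¹ * A₁), ‖m‖ < 1 := by
  constructor
  · intro h
    rw [← singularMap_zero]
    exact isExpStableMap_iff.mp (h 0)
  · intro h φ
    rw [isExpStableMap_iff]
    intro m hm
    have he : Complex.exp (Complex.I * (φ : ℂ)) ≠ 0 := Complex.exp_ne_zero _
    have hs : m = Units.mk0 _ he • ((Complex.exp (Complex.I * (φ : ℂ)))⁻¹ * m) := by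
      rw [Units.smul_mk0, smul_eq_mul, mul_inv_cancel_left₀ he]
    rw [singularMap, hs, ← Units.smul_mk0 he, spectrum.smul_mem_smul_iff] at hm
    have := h _ hm
    rwa [norm_mul, norm_inv, mul_comm Complex.I, Complex.norm_exp_ofReal_mul_I, inv_one,
      one_mul] at this

theorem isExpStableMap_or_isNeutralMap_iff {M : Matrix (Fin n) (Fin n) ℂ} :
    (IsExpStableMap M ∨ (IsNeutralMap M ∧
      ∀ φ : ℝ, Complex.exp (Complex.I * (φ : ℂ)) ∈ multipliers M →
        ∀ k : ℤ, φ ≠ 2 * Real.pi * (k : ℝ))) ↔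
      ∀ m ∈ multipliers M, ‖m‖ ≤ 1 ∧ m ≠ 1 := by
  constructor
  · rintro (h | ⟨h, hφ⟩) m hm
    · have := isExpStableMap_iff.mp h m hm
      refine ⟨this.le, ?_⟩
      rintro rfl
      simp at this
    · refine ⟨h.1 m hm, ?_⟩
      rintro rfl
      exact hφ 0 (by simpa using hm) 0 (by simp)
  · intro h
    by_cases hn : ∃ m ∈ multipliers M, ‖m‖ = 1
    · refine Or.inr ⟨⟨fun m hm => (h m hm).1, hn⟩, ?_⟩
      rintro φ hm k rfl
      refine (h _ hm).2 (Complex.exp_eq_one_iff.mpr ⟨k, ?_⟩)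
      push_cast
      ring
    · push Not at hn
      exact Or.inl (isExpStableMap_iff.mpr fun m hm => lt_of_le_of_ne (h m hm).1 (hn m hm))

theorem absolutelyStable_iff {A₀ A₁ : Matrix (Fin n) (Fin n) ℂ} :
    AbsolutelyStable A₀ A₁ ↔ IsHurwitz A₀ ∧
      (∀ ω : ℝ, ω ≠ 0 → ∀ m ∈ spectrum ℂ
        (((Complex.I * (ω : ℂ)) • (1 : Matrix (Fin n) (Fin n) ℂ) - A₀)⁻¹ * A₁), ‖m‖ < 1) ∧
      ∀ m ∈ multipliers (singularMap A₀ A₁ 0 0), ‖m‖ ≤ 1 ∧ m ≠ 1 := by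
  rw [absolutelyStable_iff_noImaginaryRoots]
  exact and_congr_right noImaginaryRoots_iff

end DelayStability
theorem mainTheorem5 (n : ℕ) (A₀ A₁ : Matrix (Fin n) (Fin n) ℂ) :
    (DelayStability.AbsolutelyStable A₀ A₁ ↔
      DelayStability.IsHurwitz A₀ ∧
      (∀ ω φ : ℝ, ω ≠ 0 →
        DelayStability.IsExpStableMap (DelayStability.singularMap A₀ A₁ ω φ)) ∧
      (∀ μ ∈ DelayStability.multipliers (DelayStability.singularMap A₀ A₁ 0 0),
        ‖μ‖ ≤ 1 ∧ μ ≠ 1)) ∧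
    (DelayStability.AbsolutelyStable A₀ A₁ ↔
      DelayStability.IsHurwitz A₀ ∧
      (∀ ω : ℝ, ω ≠ 0 →
        spectralRadius ℂ
          ((((Complex.I * (ω : ℂ)) • (1 : Matrix (Fin n) (Fin n) ℂ) - A₀)⁻¹) * A₁) < 1) ∧
      (∀ μ ∈ DelayStability.multipliers (DelayStability.singularMap A₀ A₁ 0 0),
        ‖μ‖ ≤ 1 ∧ μ ≠ 1)) ∧
    (DelayStability.AbsolutelyStable A₀ A₁ ↔
      DelayStability.IsHurwitz A₀ ∧
      (∀ ω φ : ℝ, ω ≠ 0 →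
        DelayStability.IsExpStableMap (DelayStability.singularMap A₀ A₁ ω φ)) ∧
      (DelayStability.IsExpStableMap (DelayStability.singularMap A₀ A₁ 0 0) ∨
        (DelayStability.IsNeutralMap (DelayStability.singularMap A₀ A₁ 0 0) ∧
          ∀ φ : ℝ, Complex.exp (Complex.I * (φ : ℂ)) ∈
              DelayStability.multipliers (DelayStability.singularMap A₀ A₁ 0 0) →
            ∀ k : ℤ, φ ≠ 2 * Real.pi * (k : ℝ)))) := by
  have hexp : (∀ ω φ : ℝ, ω ≠ 0 →
      DelayStability.IsExpStableMap (DelayStability.singularMap A₀ A₁ ω φ)) ↔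
      ∀ ω : ℝ, ω ≠ 0 → ∀ m ∈ spectrum ℂ
        (((Complex.I * (ω : ℂ)) • (1 : Matrix (Fin n) (Fin n) ℂ) - A₀)⁻¹ * A₁), ‖m‖ < 1 := by
    refine forall_congr' fun ω => ?_
    rw [← DelayStability.forall_isExpStableMap_singularMap_iff, forall_comm]
  rw [DelayStability.isExpStableMap_or_isNeutralMap_iff, hexp]
  simp only [DelayStability.spectralRadius_lt_one_iff]
  exact ⟨DelayStability.absolutelyStable_iff, DelayStability.absolutelyStable_iff,
    DelayStability.absolutelyStable_iff⟩
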